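/- Consider a homogeneous 3-user $2\times1$ MISO broadcast channel: all users have the same coherence time $N\ge 1$, and user $i$ has an offset $0\le n_{\delta,i}<N$, so that the fading blocks of user $i$ are $\{0,\dots,n_{\delta,i}-1\}$ (empty if $n_{\delta,i}=0$) and $\{aN+n_{\delta,i},\dots,(a+1)N+n_{\delta,i}-1\}$, $a\ge 0$. Let $h_{ij}(n)$ be the coefficient from antenna $j$ to user $i$ at time $n$; the vector $(h_{i1}(n),h_{i2}(n))$ is constant on each fading block of user $i$, the vectors of different (user, block) pairs are independent, and each of them has a law on $\mathbb C^2$ that is absolutely continuous with respect to Lebesgue measure. Take four slots $n_1<n_2<n_3<n_4$ and let $H_{ij}=\mathrm{diag}[h_{ij}(n_1),\dots,h_{ij}(n_4)]$. A BIA scheme on these slots consists of vectors $\mathbf v_1,\mathbf v_2,\mathbf v_3$ (antenna 1) and $\mathbf u_1,\mathbf u_2,\mathbf u_3$ (antenna 2) in $\mathbb C^4$, not depending on the channel realization, such that almost surely, for every user $i$, $\mathrm{span}\{H_{i1}\mathbf v_j: j\ne i\}=\mathrm{span}\{H_{i2}\mathbf u_j: j\neq i\}$, and $H_{i1}\mathbf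 v_i, H_{i2}\mathbf u_i$ are linearly independent modulo the span of all $H_{i1}\mathbf v_j,H_{i2}\mathbf u_j$ with $j\ne i$. The four slots are BIA-feasible if such a scheme exists. Their channel pattern records, for each user, which of the four slots lie in the same fading block of that user; its transition matrix $A\in\{0,1\}^{3\times3}$ has $a_{ij}=1$ if and only if $n_j$ and $n_{j+1}$ lie in different fading blocks of user $i$. Then: (1) every BIA scheme is aligned one-to-one: for every realization with all coefficients nonzero and every $k$, if $i\neq j$ are the two users other than $k$, then $\mathbf v_k$ is a nonzero multiple of $D_i\mathbf u_k$ and $D_i\mathbf u_k$ is a nonzero multiple of $D_j\mathbf u_k$, where $D_i=\mathrm{diag}\left[\frac{h_{i2}(n_1)}{h_{i1}(n_1)},\dots,\frac{h_{i2}(n_4)}{h_{i1}(n_4)}\right]$; (2) the four slots are BIA-feasible if and only if the transition matrix of their pattern is a permutation matrix; (3) for every family of block laws as above (one for each user and block index, held fixed while $N$, the offsets and the slots vary), exactly $3!=6$ channel patterns occur as the pattern of BIA-feasible slots $n_1<n_2<n_3<n_4$ in some homogeneous 3-user $2\times1$ MISO broadcast channel. -/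

import Mathlib

open MeasureTheory
open scoped Matrix

noncomputable section

namespace BIA

/-- Index of the fading block containing slot `n`, for coherence time `N` and initial offset `δ`:
the slots `0, …, δ - 1` are in block `0` (which is empty if `δ = 0`), and the slots
`a N + δ + b` with `0 ≤ b < N` are in block `a + 1`. -/
def blockIndex (N δ n : ℕ) : ℕ :=
  if n < δ then 0 else (n - δ) / N + 1

/-- Channel coefficients of all fading blocks: `H (i, a) j` is the coefficient from transmit
antenna `j` to user `i` during block `a` of user `i`. -/
abbrev Channel : Type := Fin 3 × ℕ → Fin 2 → ℂ

/-- The law of the channel under independent block fading: the coefficient vectors of distinct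
(user, block) pairs are independent, and the vector of user `i` in block `a` has
law `fading i a`. -/
def channelLaw (fading : Fin 3 → ℕ → Measure (Fin 2 → ℂ))
    [∀ i a, IsProbabilityMeasure (fading i a)] : Measure Channel :=
  Measure.infinitePi (fun p : Fin 3 × ℕ => fading p.1 p.2)

/-- The coefficient from antenna `j` to user `i` at the `t`-th chosen slot. -/
def gain (N : ℕ) (δ : Fin 3 → ℕ) (n : Fin 4 → ℕ) (H : Channel) (i : Fin 3) (j : Fin 2)
    (t : Fin 4) : ℂ :=
  H (i, blockIndex N (δ i) (n t)) j

/-- The diagonal channel matrix from antenna `j` to user `i` over the four chosen slots. -/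
def chanMatrix (N : ℕ) (δ : Fin 3 → ℕ) (n : Fin 4 → ℕ) (H : Channel) (i : Fin 3) (j : Fin 2) :
    Matrix (Fin 4) (Fin 4) ℂ :=
  Matrix.diagonal (gain N δ n H i j)

/-- Received directions, at user `i`, of the antenna-`j` streams that are meant for the other
users. Here `w` holds the signalling vectors used at antenna `j`. -/
def interference (N : ℕ) (δ : Fin 3 → ℕ) (n : Fin 4 → ℕ) (H : Channel) (i : Fin 3) (j : Fin 2)
    (w : Fin 3 → Fin 4 → ℂ) : Submodule ℂ (Fin 4 → ℂ) :=
  Submodule.span ℂ {y | ∃ k, k ≠ i ∧ y = chanMatrix N δ n H i j *ᵥ w k}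

/-- General (subspace) interference alignment at every user, for the channel realization `H`. -/
def Aligned (N : ℕ) (δ : Fin 3 → ℕ) (n : Fin 4 → ℕ) (H : Channel) (v u : Fin 3 → Fin 4 → ℂ) :
    Prop :=
  ∀ i, interference N δ n H i 0 v = interference N δ n H i 1 u

/-- Every user `i` can separate its two streams (sent along `v i` and `u i`) from each other and
from the interference, for the channel realization `H`: the two received directions are
linearly independent modulo the space spanned by all interfering directions. -/
def Decodable (N : ℕ) (δ : Fin 3 → ℕ) (n : Fin 4 → ℕ) (H : Channel) (v u : Fin 3 → Fin 4 → ℂ) :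
    Prop :=
  ∀ i, ∀ a b : ℂ,
    a • (chanMatrix N δ n H i 0 *ᵥ v i) + b • (chanMatrix N δ n H i 1 *ᵥ u i) ∈
      interference N δ n H i 0 v ⊔ interference N δ n H i 1 u → a = 0 ∧ b = 0

/-- `(v, u)` is a blind interference alignment scheme on the slots `n`: the fixed signalling
vectors `v` (first antenna) and `u` (second antenna), which do not depend on the channel
realization, give alignment and decodability almost surely. -/
def IsScheme (fading : Fin 3 → ℕ → Measure (Fin 2 → ℂ))
    [∀ i a, IsProbabilityMeasure (fading i a)]
    (N : ℕ) (δ : Fin 3 → ℕ) (n : Fin 4 → ℕ) (v u : Fin 3 → Fin 4 → ℂ) : Prop :=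
  ∀ᵐ H ∂(channelLaw fading), Aligned N δ n H v u ∧ Decodable N δ n H v u

/-- The four slots form a BIA-feasible super-symbol. -/
def Feasible (fading : Fin 3 → ℕ → Measure (Fin 2 → ℂ))
    [∀ i a, IsProbabilityMeasure (fading i a)]
    (N : ℕ) (δ : Fin 3 → ℕ) (n : Fin 4 → ℕ) : Prop :=
  ∃ v u : Fin 3 → Fin 4 → ℂ, IsScheme fading N δ n v u

/-- `x → y`: the vector `x` is a nonzero multiple of `y`. -/
def NonzeroMultiple (x y : Fin 4 → ℂ) : Prop :=
  ∃ a : ℂ, a ≠ 0 ∧ x = a • y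

/-- The diagonal matrix of the coefficient ratios (second antenna over first antenna) of
user `i` over the four chosen slots. -/
def ratioMatrix (N : ℕ) (δ : Fin 3 → ℕ) (n : Fin 4 → ℕ) (H : Channel) (i : Fin 3) :
    Matrix (Fin 4) (Fin 4) ℂ :=
  Matrix.diagonal (fun t => gain N δ n H i 1 t / gain N δ n H i 0 t)

/-- One-to-one alignment, for the channel realization `H`: with `i` and `j` the two users other
than `k`, one has `v k → D i (u k) → D j (u k)`, where `D` are the ratio matrices. -/
def OneToOneAligned (N : ℕ) (δ : Fin 3 → ℕ) (n : Fin 4 → ℕ) (H : Channel)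
    (v u : Fin 3 → Fin 4 → ℂ) : Prop :=
  ∀ k i j, i ≠ k → j ≠ k → i ≠ j →
    NonzeroMultiple (v k) (ratioMatrix N δ n H i *ᵥ u k) ∧
    NonzeroMultiple (ratioMatrix N δ n H i *ᵥ u k) (ratioMatrix N δ n H j *ᵥ u k)

/-- A 4-symbol channel pattern: for every user, which of the four slots share the same
channel state. -/
abbrev Pattern : Type := Fin 3 → Setoid (Fin 4)

/-- The channel pattern seen on the slots `n`. -/
abbrev pattern (N : ℕ) (δ : Fin 3 → ℕ) (n : Fin 4 → ℕ) : Pattern :=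
  fun i => Setoid.ker (fun t => blockIndex N (δ i) (n t))

open Classical in
/-- The transition matrix of a pattern: entry `(i, j)` is `1` if the state of user `i` changes
between the `j`-th slot and the next one, and `0` otherwise. -/
def transitionMatrix (P : Pattern) : Matrix (Fin 3) (Fin 3) ℕ :=
  Matrix.of fun i j => if (P i).r j.castSucc j.succ then 0 else 1

/-- Being a permutation matrix. -/
def IsPermutationMatrix (A : Matrix (Fin 3) (Fin 3) ℕ) : Prop :=
  ∃ σ : Equiv.Perm (Fin 3), A = σ.permMatrix ℕ

/-- The BIA-feasible 4-symbol channel patterns of homogeneous BCs: those that are seen on some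
four increasing slots of some homogeneous BC (one coherence time `N` for all users, offsets
smaller than `N`) and form a BIA-feasible super-symbol there. -/
def feasiblePatterns (fading : Fin 3 → ℕ → Measure (Fin 2 → ℂ))
    [∀ i a, IsProbabilityMeasure (fading i a)] : Set Pattern :=
  {P | ∃ (N : ℕ) (δ : Fin 3 → ℕ) (n : Fin 4 → ℕ), (∀ i, δ i < N) ∧ StrictMono n ∧
    pattern N δ n = P ∧ Feasible fading N δ n}

end BIA

end

/-! ### Atomless coefficient ratios under the fading law. -/

namespace BIA

open ProbabilityTheory

/-! Randomness is removed first. If `g` kills every `v j` with `j ≠ i`, alignment at user `i` makes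
a combination of its blocks' coefficient ratios vanish almost surely. The ratios are independent and
atomless, so every coefficient vanishes: each restriction of `g` to a block of user `i` kills `u j`,
`j ≠ i`. The same holds with `v` and `u` exchanged. Decodability makes the three `v j` and one
twisted copy of `u i` a basis of `ℂ⁴`.

Now let `f ≠ 0` kill all `v j`. Summing its block parts shows that it kills all `u j` too, so its
block parts for user `i` kill both `v j` and `u j` for `j ≠ i`. The support of `f` meets at least
two blocks of each user, as otherwise `f` would kill the whole basis. Two of these parts therefore
span the plane of functionals killing `v j`, `j ≠ i`. All functionals dual to the basis then vanish
where `f` does, so `f` has full support and each user sees exactly two blocks. Equal transitions for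
two users would force a dual functional to kill its own vector. This gives a permutation
(`IsAlgebraicScheme.exists_perm`).

Consequently `v k` and `u k` lie on one line, supported on the two slots around the transition of
user `k`. The other users are constant there, which yields one-to-one alignment for every
nonvanishing realization. Conversely, differences of adjacent unit vectors form a scheme, and the
feasible patterns correspond to the permutations of three elements. -/

/-- If the law of `Y` has no atoms and `X` is independent of `Y`, then `X + Y` is almost surely
nonzero. -/
theorem ae_add_ne_zero {Ω : Type*} [MeasurableSpace Ω] {μ : Measure Ω} [IsProbabilityMeasure μ]
    {X Y : Ω → ℂ} (hX : Measurable X) (hY : Measurable Y) (h : IndepFun X Y μ)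
    (hatom : ∀ z, μ {ω | Y ω = z} = 0) : ∀ᵐ ω ∂μ, X ω + Y ω ≠ 0 := by
  have hm : MeasurableSet {p : ℂ × ℂ | p.1 + p.2 = 0} :=
    measurableSet_eq_fun (by fun_prop) (by fun_prop)
  have hmap := (indepFun_iff_map_prod_eq_prod_map_map hX.aemeasurable hY.aemeasurable).1 h
  have : IsProbabilityMeasure (μ.map X) := Measure.isProbabilityMeasure_map hX.aemeasurable
  have : IsProbabilityMeasure (μ.map Y) := Measure.isProbabilityMeasure_map hY.aemeasurable
  have h0 : ((μ.map X).prod (μ.map Y)) {p : ℂ × ℂ | p.1 + p.2 = 0} = 0 := by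
    -- By Fubini it suffices that each slice, the single point `-x`, is null.
    rw [Measure.measure_prod_null hm]
    refine Filter.Eventually.of_forall fun x => ?_
    have hs : Prod.mk x ⁻¹' {p : ℂ × ℂ | p.1 + p.2 = 0} = {-x} := by
      ext y
      simp only [Set.mem_preimage, Set.mem_ofPred_eq, Set.mem_singleton_iff]
      exact ⟨fun hxy => eq_neg_of_add_eq_zero_right hxy, fun hy => by rw [hy]; ring⟩
    change μ.map Y (Prod.mk x ⁻¹' _) = 0
    rw [hs, Measure.map_apply hY (measurableSet_singleton _)]
    exact hatom (-x)
  rw [← hmap, Measure.map_apply (hX.prodMk hY) hm] at h0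
  rw [ae_iff]
  simpa using h0

/-- The zero set of a nonzero linear form on `ℂ²` is Lebesgue null. -/
theorem volume_setOf_linear_eq_zero (a b : ℂ) (h : a ≠ 0 ∨ b ≠ 0) :
    (volume : Measure (Fin 2 → ℂ)) {x | a * x 0 + b * x 1 = 0} = 0 := by
  let φ : (Fin 2 → ℂ) →ₗ[ℝ] ℂ :=
    { toFun := fun x => a * x 0 + b * x 1
      map_add' := fun x y => by simp only [Pi.add_apply]; ring
      map_smul' := fun r x => by
        simp only [Pi.smul_apply, Complex.real_smul, RingHom.id_apply]; ring }
  have hne : LinearMap.ker φ ≠ ⊤ := by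
    intro htop
    rw [LinearMap.ker_eq_top] at htop
    have h1 : φ ![1, 0] = 0 := by rw [htop]; rfl
    have h2 : φ ![0, 1] = 0 := by rw [htop]; rfl
    simp only [φ, LinearMap.coe_mk, AddHom.coe_mk, Matrix.cons_val_zero, Matrix.cons_val_one,
      mul_one, mul_zero, add_zero, zero_add] at h1 h2
    exact h.elim (fun h => h h1) (fun h => h h2)
  exact Measure.addHaar_submodule volume (LinearMap.ker φ) hne

section Channel

variable {fading : Fin 3 → ℕ → Measure (Fin 2 → ℂ)} [∀ i a, IsProbabilityMeasure (fading i a)]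

instance : IsProbabilityMeasure (channelLaw fading) := by
  unfold channelLaw; infer_instance

theorem channelLaw_linear_eq_zero (hfading : ∀ i a, fading i a ≪ (volume : Measure (Fin 2 → ℂ)))
    (p : Fin 3 × ℕ) (a b : ℂ) (h : a ≠ 0 ∨ b ≠ 0) :
    channelLaw fading {H | a * H p 0 + b * H p 1 = 0} = 0 := by
  have hm : MeasurableSet {x : Fin 2 → ℂ | a * x 0 + b * x 1 = 0} :=
    measurableSet_eq_fun (by fun_prop) (by fun_prop)
  have h0 := hfading p.1 p.2 (volume_setOf_linear_eq_zero a b h)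
  exact ((measurePreserving_eval_infinitePi (fun p : Fin 3 × ℕ => fading p.1 p.2)
    p).measure_preimage hm.nullMeasurableSet).trans h0

/-- Almost surely, all channel coefficients are nonzero. -/
theorem ae_ne_zero (hfading : ∀ i a, fading i a ≪ (volume : Measure (Fin 2 → ℂ))) :
    ∀ᵐ H ∂(channelLaw fading), ∀ p j, H p j ≠ 0 := by
  rw [ae_all_iff]
  intro p
  have h0 := channelLaw_linear_eq_zero hfading p 1 0 (by simp)
  have h1 := channelLaw_linear_eq_zero hfading p 0 1 (by simp)
  simp only [one_mul, zero_mul, add_zero, zero_add] at h0 h1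
  have h0' : ∀ᵐ H ∂(channelLaw fading), H p 0 ≠ 0 := by simpa [ae_iff] using h0
  have h1' : ∀ᵐ H ∂(channelLaw fading), H p 1 ≠ 0 := by simpa [ae_iff] using h1
  filter_upwards [h0', h1'] with H hH0 hH1 j
  fin_cases j
  · exact hH0
  · exact hH1

/-- The ratio of the two coefficients of a block has no atoms. -/
theorem channelLaw_ratio_eq (hfading : ∀ i a, fading i a ≪ (volume : Measure (Fin 2 → ℂ)))
    (p : Fin 3 × ℕ) {j k : Fin 2} (hjk : j ≠ k) (z : ℂ) :
    channelLaw fading {H | H p j / H p k = z} = 0 := by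
  have hsub : channelLaw fading {H | H p j - z * H p k = 0} = 0 := by
    fin_cases j <;> fin_cases k
    · exact absurd rfl hjk
    · refine measure_mono_null (fun H hH => ?_)
        (channelLaw_linear_eq_zero hfading p 1 (-z) (by simp))
      have hH' : H p 0 - z * H p 1 = 0 := hH
      change 1 * H p 0 + -z * H p 1 = 0
      linear_combination hH'
    · refine measure_mono_null (fun H hH => ?_)
        (channelLaw_linear_eq_zero hfading p (-z) 1 (by simp))
      have hH' : H p 1 - z * H p 0 = 0 := hH
      change -z * H p 0 + 1 * H p 1 = 0
      linear_combination hH'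
    · exact absurd rfl hjk
  have hne := ae_iff.1 (ae_ne_zero hfading)
  refine measure_mono_null ?_ (measure_union_null hsub hne)
  intro H hH
  -- Clearing the denominator needs it to be nonzero; the null exceptional set absorbs the
  -- convention that division by zero gives zero.
  by_cases hk : ∀ p j, H p j ≠ 0
  · left
    have h1 : H p j / H p k = z := hH
    have h2 : H p j - z * H p k = 0 := by
      rw [← h1, div_mul_cancel₀ _ (hk p k), sub_self]
    exact h2
  · right; exact hk

/-- A nontrivial linear combination of the coefficient ratios of finitely many blocks of a user
is almost surely nonzero. -/
theorem ae_sum_ratio_ne_zero (hfading : ∀ i a, fading i a ≪ (volume : Measure (Fin 2 → ℂ)))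
    (i : Fin 3) {j k : Fin 2} (hjk : j ≠ k) (s : Finset ℕ) (c : ℕ → ℂ) {b : ℕ} (hb : b ∈ s)
    (hc : c b ≠ 0) :
    ∀ᵐ H ∂(channelLaw fading), ∑ a ∈ s, c a * (H (i, a) j / H (i, a) k) ≠ 0 := by
  let X : ℕ → Channel → ℂ := fun a H => c a * (H (i, a) j / H (i, a) k)
  have hX : ∀ a, Measurable (X a) := fun a => by fun_prop
  have hind : iIndepFun X (channelLaw fading) :=
    (iIndepFun_infinitePi (P := fun p : Fin 3 × ℕ => fading p.1 p.2)
      (X := fun p x => c p.2 * (x j / x k)) (fun p => by fun_prop)).precomp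
      (g := fun a : ℕ => (i, a)) (fun a b hab => (Prod.mk.inj hab).2)
  -- The term of block `b` is atomless and independent of the sum of the others.
  have h := ae_add_ne_zero (X := ∑ a ∈ s.erase b, X a) (Y := X b) (μ := channelLaw fading)
    (by rw [Finset.sum_fn]; exact Finset.measurable_sum _ fun a _ => hX a) (hX b)
    (hind.indepFun_finsetSum_of_notMem hX (Finset.notMem_erase b s)) (fun z => by
      convert channelLaw_ratio_eq hfading (i, b) hjk (z / c b) using 4
      rw [eq_div_iff hc, mul_comm])
  filter_upwards [h] with H hH
  rw [← Finset.sum_erase_add s _ hb]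
  simpa [X] using hH

/-- A linear combination of the coefficient ratios of finitely many blocks of a user that vanishes
almost surely is trivial. -/
theorem eq_zero_of_ae_sum_ratio_eq_zero
    (hfading : ∀ i a, fading i a ≪ (volume : Measure (Fin 2 → ℂ)))
    (i : Fin 3) {j k : Fin 2} (hjk : j ≠ k) (s : Finset ℕ) (c : ℕ → ℂ)
    (h : ∀ᵐ H ∂(channelLaw fading), ∑ a ∈ s, c a * (H (i, a) j / H (i, a) k) = 0)
    {b : ℕ} (hb : b ∈ s) : c b = 0 := by
  by_contra hc
  have h' := ae_sum_ratio_ne_zero hfading i hjk s c hb hc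
  obtain ⟨H, h1, h2⟩ := (h.and h').exists
  exact h2 h1

/-- The coefficient ratios of different blocks of a user are almost surely different. -/
theorem ae_ratio_ne (hfading : ∀ i a, fading i a ≪ (volume : Measure (Fin 2 → ℂ)))
    (i : Fin 3) {a b : ℕ} (hab : a ≠ b) :
    ∀ᵐ H ∂(channelLaw fading), H (i, a) 1 / H (i, a) 0 ≠ H (i, b) 1 / H (i, b) 0 := by
  have h := ae_sum_ratio_ne_zero hfading i (one_ne_zero : (1 : Fin 2) ≠ 0) {a, b}
    (fun t => if t = a then 1 else -1) (Finset.mem_insert_self a {b}) (by simp)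
  filter_upwards [h] with H hH heq
  apply hH
  rw [Finset.sum_pair hab, if_pos rfl, if_neg hab.symm, heq]
  ring

end Channel

end BIA

/-! ### Block parts of functionals and duality in `ℂ⁴`. -/

namespace BIA

/-- The part of `g` that lives on the slots in block `b`. -/
def blockPart (β : Fin 4 → ℕ) (b : ℕ) (g : Fin 4 → ℂ) : Fin 4 → ℂ :=
  fun t => if β t = b then g t else 0

theorem blockPart_dotProduct (β : Fin 4 → ℕ) (b : ℕ) (g w : Fin 4 → ℂ) :
    blockPart β b g ⬝ᵥ w = ∑ t, if β t = b then g t * w t else 0 := by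
  simp only [dotProduct, blockPart, ite_mul, zero_mul]

/-- Summing over blocks: a block-constant weight `x` may be taken out of every block. -/
theorem sum_mul_blockPart_dotProduct (β : Fin 4 → ℕ) (x : ℕ → ℂ) (g w : Fin 4 → ℂ) :
    ∑ b ∈ Finset.univ.image β, (blockPart β b g ⬝ᵥ w) * x b = ∑ t, g t * (x (β t) * w t) := by
  simp only [blockPart_dotProduct, Finset.sum_mul, ite_mul, zero_mul]
  rw [Finset.sum_comm]
  refine Finset.sum_congr rfl fun t _ => ?_
  rw [Finset.sum_ite_eq, if_pos (Finset.mem_image_of_mem β (Finset.mem_univ t))]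
  ring

theorem dotProduct_eq_zero_of_blockPart (β : Fin 4 → ℕ) (g w : Fin 4 → ℂ)
    (h : ∀ b, blockPart β b g ⬝ᵥ w = 0) : g ⬝ᵥ w = 0 := by
  have h1 := sum_mul_blockPart_dotProduct β (fun _ => 1) g w
  simp only [h, zero_mul, Finset.sum_const_zero, one_mul] at h1
  exact h1.symm

/-- In a space on which the pair of functionals `z₁`, `z₂` is injective, two independent vectors
span everything. -/
theorem exists_eq_smul_add_smul (A : Submodule ℂ (Fin 4 → ℂ)) (z₁ z₂ : Fin 4 → ℂ)
    (hz : ∀ g ∈ A, g ⬝ᵥ z₁ = 0 → g ⬝ᵥ z₂ = 0 → g = 0) {p q g : Fin 4 → ℂ}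
    (hp : p ∈ A) (hq : q ∈ A) (hg : g ∈ A) (hpq : ∀ a b : ℂ, a • p + b • q = 0 → a = 0 ∧ b = 0) :
    ∃ a b : ℂ, g = a • p + b • q := by
  have key : ∀ a b : ℂ, a * (p ⬝ᵥ z₁) + b * (q ⬝ᵥ z₁) = 0 →
      a * (p ⬝ᵥ z₂) + b * (q ⬝ᵥ z₂) = 0 → a = 0 ∧ b = 0 := fun a b h1 h2 =>
    hpq a b (hz _ (A.add_mem (A.smul_mem a hp) (A.smul_mem b hq))
      (by simpa only [add_dotProduct, smul_dotProduct, smul_eq_mul] using h1)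
      (by simpa only [add_dotProduct, smul_dotProduct, smul_eq_mul] using h2))
  -- If the determinant vanished, its rows would give kernel vectors, forcing all four values to be
  -- zero and contradicting `key`. The coefficients below come from Cramer's rule.
  have hΔ : (p ⬝ᵥ z₁) * (q ⬝ᵥ z₂) - (p ⬝ᵥ z₂) * (q ⬝ᵥ z₁) ≠ 0 := by
    intro hΔ
    have h2 := key (q ⬝ᵥ z₂) (-(p ⬝ᵥ z₂)) (by linear_combination hΔ) (by ring)
    have h1 := key (q ⬝ᵥ z₁) (-(p ⬝ᵥ z₁)) (by ring) (by linear_combination -hΔ)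
    have h := key 1 0 (by linear_combination -h1.2) (by linear_combination -h2.2)
    exact one_ne_zero h.1
  obtain ⟨d, hd⟩ : ∃ d : ℂ, d * ((p ⬝ᵥ z₁) * (q ⬝ᵥ z₂) - (p ⬝ᵥ z₂) * (q ⬝ᵥ z₁)) = 1 :=
    ⟨_, inv_mul_cancel₀ hΔ⟩
  refine ⟨((g ⬝ᵥ z₁) * (q ⬝ᵥ z₂) - (g ⬝ᵥ z₂) * (q ⬝ᵥ z₁)) * d,
    ((p ⬝ᵥ z₁) * (g ⬝ᵥ z₂) - (p ⬝ᵥ z₂) * (g ⬝ᵥ z₁)) * d, ?_⟩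
  rw [← sub_eq_zero]
  refine hz _ (A.sub_mem hg (A.add_mem (A.smul_mem _ hp) (A.smul_mem _ hq))) ?_ ?_
  · simp only [sub_dotProduct, add_dotProduct, smul_dotProduct, smul_eq_mul]
    linear_combination -(g ⬝ᵥ z₁) * hd
  · simp only [sub_dotProduct, add_dotProduct, smul_dotProduct, smul_eq_mul]
    linear_combination -(g ⬝ᵥ z₂) * hd

/-- Functionals dual to a basis of `ℂ⁴`. -/
theorem exists_dual_basis (v : Fin 3 → Fin 4 → ℂ) (w : Fin 4 → ℂ)
    (h : ∀ (a : Fin 3 → ℂ) (b : ℂ), ∑ j, a j • v j + b • w = 0 → a = 0 ∧ b = 0) :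
    ∃ (f : Fin 4 → ℂ) (g : Fin 3 → Fin 4 → ℂ), (∀ j, f ⬝ᵥ v j = 0) ∧ f ⬝ᵥ w = 1 ∧
      (∀ i j, g i ⬝ᵥ v j = if j = i then 1 else 0) ∧
      (∀ e, f ⬝ᵥ e = 0 → (∀ i, g i ⬝ᵥ e = 0) → e = 0) ∧
      (∀ e, (∀ j, e ⬝ᵥ v j = 0) → e ⬝ᵥ w = 0 → e = 0) := by
  -- The basis vectors are the rows of `M`, so the columns of `M⁻¹` are the dual functionals.
  let M : Matrix (Fin 4) (Fin 4) ℂ := Matrix.of (Fin.snoc (α := fun _ => Fin 4 → ℂ) v w)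
  have hcast : ∀ j : Fin 3, M j.castSucc = v j := fun j => by
    change (Fin.snoc (α := fun _ => Fin 4 → ℂ) v w : Fin 4 → Fin 4 → ℂ) j.castSucc = v j
    exact Fin.snoc_castSucc (α := fun _ => Fin 4 → ℂ) ..
  have hlast : M (Fin.last 3) = w := by
    change (Fin.snoc (α := fun _ => Fin 4 → ℂ) v w : Fin 4 → Fin 4 → ℂ) (Fin.last 3) = w
    exact Fin.snoc_last (α := fun _ => Fin 4 → ℂ) ..
  have hunit : IsUnit M := by
    rw [← Matrix.vecMul_injective_iff_isUnit]
    refine (injective_iff_map_eq_zero (Matrix.vecMulLinear M)).2 fun c hc => ?_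
    have hc' : ∑ i, c i • M i = 0 := by
      rw [← Matrix.vecMul_eq_sum]; exact hc
    rw [Fin.sum_univ_castSucc] at hc'
    simp only [hcast, hlast] at hc'
    obtain ⟨h1, h2⟩ := h _ _ hc'
    funext t
    refine Fin.lastCases h2 (fun j => congrFun h1 j) t
  have hdet := (Matrix.isUnit_iff_isUnit_det M).1 hunit
  have hMG : ∀ s t : Fin 4, (fun k => M⁻¹ k t) ⬝ᵥ M s = if s = t then 1 else 0 := fun s t => by
    have := congrFun (congrFun (Matrix.mul_nonsing_inv M hdet) s) t
    rw [Matrix.one_apply] at this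
    rw [← this, dotProduct_comm]
    rfl
  refine ⟨fun k => M⁻¹ k (Fin.last 3), fun i k => M⁻¹ k i.castSucc, fun j => ?_, ?_,
    fun i j => ?_, fun e h1 h2 => ?_, fun e h1 h2 => ?_⟩
  · rw [← hcast, hMG, if_neg (Fin.castSucc_lt_last j).ne]
  · rw [← hlast, hMG, if_pos rfl]
  · rw [← hcast, hMG]
    simp only [Fin.castSucc_inj]
  · have h3 : e ᵥ* M⁻¹ = 0 := by
      funext t
      change e ⬝ᵥ (fun k => M⁻¹ k t) = 0
      rw [dotProduct_comm]
      exact Fin.lastCases h1 h2 t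
    have h4 := congrArg (fun y => y ᵥ* M) h3
    simpa only [Matrix.vecMul_vecMul, Matrix.nonsing_inv_mul M hdet, Matrix.vecMul_one,
      Matrix.zero_vecMul] using h4
  · have h3 : M *ᵥ e = 0 := by
      funext t
      change M t ⬝ᵥ e = 0
      rw [dotProduct_comm]
      refine Fin.lastCases ?_ (fun j => ?_) t
      · rw [hlast]; exact h2
      · rw [hcast]; exact h1 j
    have h4 := congrArg (fun y => M⁻¹ *ᵥ y) h3
    simpa only [Matrix.mulVec_mulVec, Matrix.nonsing_inv_mul M hdet, Matrix.one_mulVec,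
      Matrix.mulVec_zero] using h4

/-! ### Deterministic structure: one transition per user, at distinct places. -/

/-- The algebraic content of a scheme on slots with block indices `β`: the functionals vanishing
on the interference at user `i` are stable under restriction to blocks of user `i`, and the
desired directions are independent modulo the interference. -/
structure IsAlgebraicScheme (β : Fin 3 → Fin 4 → ℕ) (v u : Fin 3 → Fin 4 → ℂ) : Prop where
  mono : ∀ i, Monotone (β i)
  dot_u : ∀ i g, (∀ j, j ≠ i → g ⬝ᵥ v j = 0) → ∀ b j, j ≠ i → blockPart (β i) b g ⬝ᵥ u j = 0
  dot_v : ∀ i g, (∀ j, j ≠ i → g ⬝ᵥ u j = 0) → ∀ b j, j ≠ i → blockPart (β i) b g ⬝ᵥ v j = 0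
  indep : ∀ i, ∃ x : ℕ → ℂ, ∀ (a : Fin 3 → ℂ) (b : ℂ),
    ∑ j, a j • v j + b • (fun t => x (β i t) * u i t) = 0 → a = 0 ∧ b = 0

theorem exists_ne_fin_three (j : Fin 3) : ∃ i : Fin 3, j ≠ i := by
  fin_cases j
  · exact ⟨1, by decide⟩
  · exact ⟨0, by decide⟩
  · exact ⟨0, by decide⟩

/-- A monotone sequence on four slots with exactly two values has exactly one transition. -/
theorem exists_transition {β : Fin 4 → ℕ} (hβ : Monotone β) {s t : Fin 4} (hst : β s ≠ β t)
    (h : ∀ r, β r = β s ∨ β r = β t) :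
    ∃ c : Fin 3, ∀ j : Fin 3, β j.castSucc = β j.succ ↔ j ≠ c := by
  have h01 : β 0 ≤ β 1 := hβ (by decide)
  have h12 : β 1 ≤ β 2 := hβ (by decide)
  have h23 : β 2 ≤ β 3 := hβ (by decide)
  have e0 := h 0
  have e1 := h 1
  have e2 := h 2
  have e3 := h 3
  have hne : ¬ (β 0 = β 1 ∧ β 1 = β 2 ∧ β 2 = β 3) := by
    rintro ⟨a, b, c⟩
    have : ∀ r : Fin 4, β r = β 0 := by
      intro r
      fin_cases r
      · rfl
      · exact a.symm
      · exact (a.trans b).symm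
      · exact (a.trans (b.trans c)).symm
    exact hst ((this s).trans (this t).symm)
  generalize β s = x at *
  generalize β t = y at *
  have key : ∀ c : Fin 3, (β 0 = β 1 ↔ 0 ≠ c) → (β 1 = β 2 ↔ 1 ≠ c) → (β 2 = β 3 ↔ 2 ≠ c) →
      ∀ j : Fin 3, β j.castSucc = β j.succ ↔ j ≠ c := by
    intro c h0 h1 h2 j
    fin_cases j
    · exact h0
    · exact h1
    · exact h2
  by_cases c0 : β 0 = β 1
  · by_cases c1 : β 1 = β 2
    · exact ⟨2, key 2 (iff_of_true c0 (by decide)) (iff_of_true c1 (by decide))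
        (iff_of_false (by omega) (by decide))⟩
    · exact ⟨1, key 1 (iff_of_true c0 (by decide)) (iff_of_false c1 (by decide))
        (iff_of_true (by omega) (by decide))⟩
  · exact ⟨0, key 0 (iff_of_false c0 (by decide)) (iff_of_true (by omega) (by decide))
      (iff_of_true (by omega) (by decide))⟩

/-- Two slots lie in the same block if and only if they are on the same side of the only
transition. -/
theorem eq_iff_of_transition {β : Fin 4 → ℕ} (hβ : Monotone β) {c : Fin 3}
    (hc : ∀ j : Fin 3, β j.castSucc = β j.succ ↔ j ≠ c) (s t : Fin 4) :
    β s = β t ↔ (s ≤ c.castSucc ↔ t ≤ c.castSucc) := by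
  have h01 : β 0 ≤ β 1 := hβ (by decide)
  have h12 : β 1 ≤ β 2 := hβ (by decide)
  have h23 : β 2 ≤ β 3 := hβ (by decide)
  have e0 : β 0 = β 1 ↔ 0 ≠ c := hc 0
  have e1 : β 1 = β 2 ↔ 1 ≠ c := hc 1
  have e2 : β 2 = β 3 ↔ 2 ≠ c := hc 2
  fin_cases c <;>
  simp only [Fin.zero_eta, Fin.mk_one, Fin.reduceFinMk, Fin.isValue, ne_eq, Fin.reduceEq,
    not_true, not_false_eq_true, iff_true, iff_false] at e0 e1 e2 <;>
  fin_cases s <;> fin_cases t <;>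
  simp only [Fin.zero_eta, Fin.mk_one, Fin.reduceFinMk, Fin.isValue, Fin.castSucc_zero,
    Fin.castSucc_one, Fin.reduceCastSucc, Fin.reduceLE, Fin.le_refl, iff_true, iff_false,
    not_true] <;> omega

namespace IsAlgebraicScheme

variable {β : Fin 3 → Fin 4 → ℕ} {v u : Fin 3 → Fin 4 → ℂ}

/-- The blocks of every user have exactly one transition, at different places for different
users, and the vectors `v k`, `u k` are annihilated by the block parts of a functional of full
support. -/
theorem exists_perm (hs : IsAlgebraicScheme β v u) :
    ∃ (σ : Equiv.Perm (Fin 3)) (f : Fin 4 → ℂ),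
      (∀ i j, β i j.castSucc = β i j.succ ↔ j ≠ σ i) ∧ (∀ t, f t ≠ 0) ∧
      (∀ k, v k ≠ 0) ∧ (∀ k, u k ≠ 0) ∧
      (∀ i k b, k ≠ i → blockPart (β i) b f ⬝ᵥ v k = 0 ∧ blockPart (β i) b f ⬝ᵥ u k = 0) := by
  choose x hx using hs.indep
  obtain ⟨f, g, hfv, hfw, hgv, hfull, -⟩ := exists_dual_basis v _ (hx 0)
  have hf0 : f ≠ 0 := by
    rintro rfl
    rw [zero_dotProduct] at hfw
    exact zero_ne_one hfw
  have hinj : ∀ i e, (∀ j, e ⬝ᵥ v j = 0) → e ⬝ᵥ (fun t => x i (β i t) * u i t) = 0 → e = 0 :=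
    fun i => by
      obtain ⟨-, -, -, -, -, -, h⟩ := exists_dual_basis v _ (hx i)
      exact h
  have hPu : ∀ i k b, k ≠ i → blockPart (β i) b f ⬝ᵥ u k = 0 := fun i k b hk =>
    hs.dot_u i f (fun j _ => hfv j) b k hk
  -- Summing the block parts for any user other than `k` removes the restriction to blocks.
  have hfu : ∀ k, f ⬝ᵥ u k = 0 := fun k => by
    obtain ⟨i, hi⟩ := exists_ne_fin_three k
    exact dotProduct_eq_zero_of_blockPart (β i) f (u k) fun b => hPu i k b hi
  have hPv : ∀ i k b, k ≠ i → blockPart (β i) b f ⬝ᵥ v k = 0 := fun i k b hk =>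
    hs.dot_v i f (fun j _ => hfu j) b k hk
  have hfw' : ∀ i, f ⬝ᵥ (fun t => x i (β i t) * u i t) ≠ 0 := fun i h => hf0 (hinj i f hfv h)
  -- If `f` lived on one block, the twist by `x i` would be a scalar there, and `f` would kill the
  -- twisted `u i`.
  have htwo : ∀ i, ∃ s t, f s ≠ 0 ∧ f t ≠ 0 ∧ β i s ≠ β i t := by
    intro i
    by_contra! hcon
    obtain ⟨s, hs0⟩ := Function.ne_iff.1 hf0
    apply hfw' i
    have : f ⬝ᵥ (fun t => x i (β i t) * u i t) = x i (β i s) * (f ⬝ᵥ u i) := by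
      simp only [dotProduct, Finset.mul_sum]
      refine Finset.sum_congr rfl fun t _ => ?_
      by_cases ht : f t = 0
      · simp only [ht, zero_mul, mul_zero]
      · rw [hcon s t hs0 ht]; ring
    rw [this, hfu, mul_zero]
  choose s t hfs hft hst using htwo
  -- Evaluation at `v i` and at the twisted `u i` is injective on this annihilator, so two block
  -- parts with disjoint supports span it.
  have hspan : ∀ i e, (∀ j, j ≠ i → e ⬝ᵥ v j = 0) →
      ∃ a b : ℂ, e = a • blockPart (β i) (β i (s i)) f + b • blockPart (β i) (β i (t i)) f := by
    intro i e he
    let A : Submodule ℂ (Fin 4 → ℂ) :=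
      { carrier := {e | ∀ j, j ≠ i → e ⬝ᵥ v j = 0}
        add_mem' := fun {a b} ha hb j hj => by rw [add_dotProduct, ha j hj, hb j hj, add_zero]
        zero_mem' := fun j _ => zero_dotProduct _
        smul_mem' := fun c a ha j hj => by rw [smul_dotProduct, ha j hj, smul_zero] }
    refine exists_eq_smul_add_smul A (v i) (fun r => x i (β i r) * u i r) ?_
      (fun j hj => hPv i j _ hj) (fun j hj => hPv i j _ hj) he ?_
    · intro e he h1 h2
      refine hinj i e (fun j => ?_) h2
      by_cases hj : j = i
      · rw [hj]; exact h1
      · exact he j hj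
    · intro a b hab
      have h1 := congrFun hab (s i)
      have h2 := congrFun hab (t i)
      simp only [Pi.add_apply, Pi.smul_apply, blockPart, if_true, if_neg (hst i),
        if_neg (hst i).symm, smul_eq_mul, mul_zero, add_zero, zero_add, Pi.zero_apply,
        mul_eq_zero] at h1 h2
      exact ⟨h1.resolve_right (hfs i), h2.resolve_right (hft i)⟩
  have hgA : ∀ i j, j ≠ i → g i ⬝ᵥ v j = 0 := fun i j hj => by rw [hgv, if_neg hj]
  -- At a zero `r` of `f` all dual functionals vanish, so they would not separate the unit vector at
  -- `r` from zero.
  have hsupp : ∀ r, f r ≠ 0 := by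
    intro r hr
    have h0 : (Pi.single r 1 : Fin 4 → ℂ) = 0 := by
      refine hfull _ (by rw [dotProduct_single, hr, zero_mul]) fun i => ?_
      obtain ⟨a, b, hab⟩ := hspan i (g i) (hgA i)
      rw [dotProduct_single, hab]
      simp only [Pi.add_apply, Pi.smul_apply, blockPart, hr, ite_self, smul_zero, add_zero,
        zero_mul]
    have := congrFun h0 r
    rw [Pi.single_eq_same] at this
    exact one_ne_zero this
  -- Since `f` is itself a combination of the two parts, its full support leaves no third block.
  have hcover : ∀ i r, β i r = β i (s i) ∨ β i r = β i (t i) := by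
    intro i r
    by_contra! hcon
    obtain ⟨a, b, hab⟩ := hspan i f (fun j _ => hfv j)
    have := congrFun hab r
    simp only [Pi.add_apply, Pi.smul_apply, blockPart, if_neg hcon.1, if_neg hcon.2, smul_zero,
      add_zero] at this
    exact hsupp r this
  choose σ hσ using fun i => exists_transition (hs.mono i) (hst i) (hcover i)
  -- With a common transition, `g i` would be a combination of block parts for user `j`, which kill
  -- `v i`, although `g i ⬝ᵥ v i = 1`.
  have hσinj : Function.Injective σ := by
    intro i j hij
    by_contra hne
    have hker : ∀ r r', β i r = β i r' ↔ β j r = β j r' := fun r r' => by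
      rw [eq_iff_of_transition (hs.mono i) (hσ i), eq_iff_of_transition (hs.mono j) (hσ j), hij]
    have hpart : ∀ r, blockPart (β i) (β i r) f = blockPart (β j) (β j r) f := fun r => by
      funext r'
      simp only [blockPart, hker]
    obtain ⟨a, b, hab⟩ := hspan i (g i) (hgA i)
    have h1 := hgv i i
    rw [hab, hpart, hpart, add_dotProduct, smul_dotProduct, smul_dotProduct, hPv j i _ hne,
      hPv j i _ hne, if_pos rfl, smul_zero, smul_zero, add_zero] at h1
    exact zero_ne_one h1
  refine ⟨Equiv.ofBijective σ (Finite.injective_iff_bijective.1 hσinj), f, hσ, hsupp,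
    fun k hk => ?_, fun k hk => ?_, fun i k b hk => ⟨hPv i k b hk, hPu i k b hk⟩⟩
  · have h1 := hgv k k
    rw [hk, dotProduct_zero, if_pos rfl] at h1
    exact zero_ne_one h1
  · apply hfw' k
    simp only [hk, Pi.zero_apply, mul_zero, dotProduct, Finset.sum_const_zero]

end IsAlgebraicScheme

/-! ### Vectors killed by two users' block parts. -/

/-- The block parts of a functional vanish on `w` only if its prefix up to the transition and its
total do. -/
theorem prefix_sum_eq_zero_of_blockPart {β : Fin 4 → ℕ} (hβ : Monotone β) {c : Fin 3}
    (hc : ∀ j : Fin 3, β j.castSucc = β j.succ ↔ j ≠ c) (f w : Fin 4 → ℂ)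
    (h : ∀ b, blockPart β b f ⬝ᵥ w = 0) :
    (∑ t : Fin 4, if t ≤ c.castSucc then f t * w t else 0) = 0 ∧ ∑ t, f t * w t = 0 := by
  refine ⟨?_, dotProduct_eq_zero_of_blockPart β f w h⟩
  refine Eq.trans ?_ (h (β c.castSucc))
  rw [blockPart_dotProduct]
  refine Finset.sum_congr rfl fun t _ => ?_
  simp only [eq_iff_of_transition hβ hc, le_refl, iff_true]

/-- A vector annihilated by the block parts of two users with different transitions is supported
on the two slots around the third possible transition. -/
theorem eq_smul_of_blockPart {f w : Fin 4 → ℂ} (hf : ∀ t, f t ≠ 0) {c d p : Fin 3}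
    (hcd : c ≠ d) (hcp : c ≠ p) (hdp : d ≠ p)
    (hc : (∑ t : Fin 4, if t ≤ c.castSucc then f t * w t else 0) = 0)
    (hd : (∑ t : Fin 4, if t ≤ d.castSucc then f t * w t else 0) = 0)
    (h : ∑ t, f t * w t = 0) :
    w = (f p.castSucc * w p.castSucc) •
      (Pi.single p.castSucc (f p.castSucc)⁻¹ - Pi.single p.succ (f p.succ)⁻¹) := by
  obtain ⟨y, hy⟩ : ∃ y : Fin 4 → ℂ, ∀ t, f t * w t = y t := ⟨fun t => f t * w t, fun _ => rfl⟩
  have hw : ∀ t, w t = y t * (f t)⁻¹ := fun t => by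
    rw [← hy, mul_comm, inv_mul_cancel_left₀ (hf t)]
  simp only [hy] at hc hd h ⊢
  -- Three independent linear conditions on four unknowns leave a line: opposite entries at the
  -- slots around `p`.
  have key : ∀ t, y t = y p.castSucc *
      ((if t = p.castSucc then 1 else 0) - if t = p.succ then 1 else 0) := by
    simp only [Fin.sum_univ_four] at hc hd h
    intro t
    fin_cases c <;> fin_cases d <;> fin_cases p <;> first | contradiction | skip
    all_goals
      simp at hc hd h
      fin_cases t <;> simp <;> grind
  funext t
  rw [hw, key]
  simp only [Pi.smul_apply, Pi.sub_apply, Pi.single_apply, smul_eq_mul]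
  by_cases h1 : t = p.castSucc
  · have h2 : t ≠ p.succ := by rw [h1]; exact p.castSucc_lt_succ.ne
    rw [if_pos h1, if_neg h2, if_pos h1, if_neg h2, h1]
    ring
  · by_cases h2 : t = p.succ
    · rw [if_neg h1, if_pos h2, if_neg h1, if_pos h2, h2]
      ring
    · rw [if_neg h1, if_neg h2, if_neg h1, if_neg h2]
      ring

end BIA

/-! ### From almost sure schemes to algebra, and one-to-one alignment. -/

namespace BIA

theorem blockIndex_monotone (N δ : ℕ) : Monotone (blockIndex N δ) := by
  intro m n hmn
  unfold blockIndex
  by_cases hn : n < δ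
  · rw [if_pos (hmn.trans_lt hn)]
    exact Nat.zero_le _
  · rw [if_neg hn]
    by_cases hm : m < δ
    · rw [if_pos hm]
      exact Nat.zero_le _
    · rw [if_neg hm]
      exact Nat.add_le_add_right (Nat.div_le_div_right (Nat.sub_le_sub_right hmn δ)) 1

section Scheme

variable {fading : Fin 3 → ℕ → Measure (Fin 2 → ℂ)} [∀ i a, IsProbabilityMeasure (fading i a)]
  {N : ℕ} {δ : Fin 3 → ℕ} {n : Fin 4 → ℕ} {H : Channel} {v u : Fin 3 → Fin 4 → ℂ}

theorem chanMatrix_mulVec (i : Fin 3) (j : Fin 2) (w : Fin 4 → ℂ) (t : Fin 4) :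
    (chanMatrix N δ n H i j *ᵥ w) t = H (i, blockIndex N (δ i) (n t)) j * w t :=
  Matrix.mulVec_diagonal _ _ _

theorem ratioMatrix_mulVec (i : Fin 3) (w : Fin 4 → ℂ) (t : Fin 4) :
    (ratioMatrix N δ n H i *ᵥ w) t =
      H (i, blockIndex N (δ i) (n t)) 1 / H (i, blockIndex N (δ i) (n t)) 0 * w t :=
  Matrix.mulVec_diagonal _ _ _

/-- If the interference of antenna `k` at user `i` is almost surely contained in that of antenna
`j`, then every functional vanishing on the signalling vectors of antenna `j` vanishes on the block
parts of those of antenna `k`. -/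
theorem blockPart_dotProduct_eq_zero_of_interference
    (hfading : ∀ i a, fading i a ≪ (volume : Measure (Fin 2 → ℂ))) {j k : Fin 2} (hjk : j ≠ k)
    (i : Fin 3) {w w' : Fin 3 → Fin 4 → ℂ}
    (h : ∀ᵐ H ∂(channelLaw fading), interference N δ n H i k w' ≤ interference N δ n H i j w)
    {g : Fin 4 → ℂ} (hg : ∀ l, l ≠ i → g ⬝ᵥ w l = 0) (b : ℕ) {l : Fin 3} (hl : l ≠ i) :
    blockPart (fun t => blockIndex N (δ i) (n t)) b g ⬝ᵥ w' l = 0 := by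
  set β : Fin 4 → ℕ := fun t => blockIndex N (δ i) (n t) with hβ
  by_cases hb : b ∈ Finset.univ.image β
  · refine eq_zero_of_ae_sum_ratio_eq_zero hfading i hjk.symm (Finset.univ.image β)
      (fun b => blockPart β b g ⬝ᵥ w' l) ?_ hb
    filter_upwards [h, ae_ne_zero hfading] with H hH hne
    rw [sum_mul_blockPart_dotProduct β (fun b => H (i, b) k / H (i, b) j)]
    have hmem : chanMatrix N δ n H i k *ᵥ w' l ∈ interference N δ n H i j w :=
      hH (Submodule.subset_span ⟨l, hl, rfl⟩)
    -- Undoing antenna `j`'s channel turns `g` into a functional that kills the interference.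
    have hker : ∀ y ∈ interference N δ n H i j w, ∑ t, g t * (y t / H (i, β t) j) = 0 := by
      intro y hy
      induction hy using Submodule.span_induction with
      | mem y hy =>
        obtain ⟨m, hm, rfl⟩ := hy
        rw [← hg m hm, dotProduct]
        refine Finset.sum_congr rfl fun t _ => ?_
        rw [chanMatrix_mulVec, mul_div_cancel_left₀ _ (hne _ _)]
      | zero => simp only [Pi.zero_apply, zero_div, mul_zero, Finset.sum_const_zero]
      | add x y _ _ hx hy =>
        simp only [Pi.add_apply, add_div, mul_add, Finset.sum_add_distrib, hx, hy, add_zero]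
      | smul c y _ hy =>
        have : ∀ t, g t * ((c • y) t / H (i, β t) j) = c * (g t * (y t / H (i, β t) j)) :=
          fun t => by rw [Pi.smul_apply, smul_eq_mul]; ring
        simp only [this, ← Finset.mul_sum, hy, mul_zero]
    rw [← hker _ hmem]
    refine Finset.sum_congr rfl fun t _ => ?_
    rw [chanMatrix_mulVec, mul_div_right_comm]
  · have : blockPart β b g = 0 := by
      funext t
      exact if_neg fun ht : β t = b => hb (ht ▸ Finset.mem_image_of_mem β (Finset.mem_univ t))
    rw [this, zero_dotProduct]

/-- The desired directions at user `i` are independent of each other and of the interference. -/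
theorem Decodable.indep (hD : Decodable N δ n H v u)
    (hne : ∀ p j, H p j ≠ 0) (i : Fin 3) (a : Fin 3 → ℂ) (b : ℂ)
    (h : ∑ j, a j • v j + b • (fun t => H (i, blockIndex N (δ i) (n t)) 1 /
      H (i, blockIndex N (δ i) (n t)) 0 * u i t) = 0) : a = 0 ∧ b = 0 := by
  have hsplit : ∀ l : Fin 3, ∑ j, a j • v j = a l • v l + ∑ j ∈ Finset.univ.erase l, a j • v j :=
    fun l => (Finset.add_sum_erase _ _ (Finset.mem_univ l)).symm
  have hmem : ∀ l : Fin 3, chanMatrix N δ n H l 0 *ᵥ (∑ j ∈ Finset.univ.erase l, a j • v j) ∈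
      interference N δ n H l 0 v ⊔ interference N δ n H l 1 u := by
    intro l
    rw [Matrix.mulVec_sum]
    refine Submodule.sum_mem _ fun j hj => ?_
    rw [Matrix.mulVec_smul]
    exact Submodule.smul_mem _ _ (Submodule.mem_sup_left
      (Submodule.subset_span ⟨j, Finset.ne_of_mem_erase hj, rfl⟩))
  -- User `i` decodes both of its own coefficients; with `b = 0`, each user `l` then forces its own
  -- `a l = 0`.
  have hi : a i = 0 ∧ b = 0 := by
    refine hD i _ _ ?_
    have h1 : a i • (chanMatrix N δ n H i 0 *ᵥ v i) + b • (chanMatrix N δ n H i 1 *ᵥ u i) =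
        -(chanMatrix N δ n H i 0 *ᵥ (∑ j ∈ Finset.univ.erase i, a j • v j)) := by
      rw [hsplit i] at h
      have h2 := congrArg (fun y => chanMatrix N δ n H i 0 *ᵥ y) h
      simp only [Matrix.mulVec_add, Matrix.mulVec_smul, Matrix.mulVec_zero] at h2
      have h3 : chanMatrix N δ n H i 0 *ᵥ (fun t => H (i, blockIndex N (δ i) (n t)) 1 /
          H (i, blockIndex N (δ i) (n t)) 0 * u i t) = chanMatrix N δ n H i 1 *ᵥ u i := by
        funext t
        rw [chanMatrix_mulVec, chanMatrix_mulVec, ← mul_assoc, mul_div_cancel₀ _ (hne _ _)]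
      rw [h3] at h2
      rw [eq_neg_iff_add_eq_zero, ← h2]
      abel
    rw [h1]
    exact Submodule.neg_mem _ (hmem i)
  rw [hi.2, zero_smul, add_zero] at h
  refine ⟨funext fun l => ?_, hi.2⟩
  refine (hD l (a l) 0 ?_).1
  have h1 : a l • (chanMatrix N δ n H l 0 *ᵥ v l) + (0 : ℂ) • (chanMatrix N δ n H l 1 *ᵥ u l) =
      -(chanMatrix N δ n H l 0 *ᵥ (∑ j ∈ Finset.univ.erase l, a j • v j)) := by
    rw [hsplit l] at h
    have h2 := congrArg (fun y => chanMatrix N δ n H l 0 *ᵥ y) h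
    simp only [Matrix.mulVec_add, Matrix.mulVec_smul, Matrix.mulVec_zero] at h2
    rw [eq_neg_iff_add_eq_zero, zero_smul, add_zero, h2]
  rw [h1]
  exact Submodule.neg_mem _ (hmem l)

theorem IsScheme.isAlgebraicScheme
    (hfading : ∀ i a, fading i a ≪ (volume : Measure (Fin 2 → ℂ))) (hn : StrictMono n)
    (hs : IsScheme fading N δ n v u) :
    IsAlgebraicScheme (fun i t => blockIndex N (δ i) (n t)) v u where
  mono i := (blockIndex_monotone N (δ i)).comp hn.monotone
  dot_u i _ hg b _ hj := blockPart_dotProduct_eq_zero_of_interference hfading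
    (zero_ne_one : (0 : Fin 2) ≠ 1) i (hs.mono fun _ hH => (hH.1 i).ge) hg b hj
  dot_v i _ hg b _ hj := blockPart_dotProduct_eq_zero_of_interference hfading
    (one_ne_zero : (1 : Fin 2) ≠ 0) i (hs.mono fun _ hH => (hH.1 i).le) hg b hj
  indep i := by
    obtain ⟨H, hH, hne⟩ := (hs.and (ae_ne_zero hfading)).exists
    exact ⟨fun b => H (i, b) 1 / H (i, b) 0, fun a b h => hH.2.indep hne i a b h⟩

/-- A vector supported on two adjacent slots in the same block of user `i` is an eigenvector of
the channel of user `i`. -/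
theorem block_mul_sub_single {β : Fin 4 → ℕ} {p : Fin 3} (hp : β p.castSucc = β p.succ)
    (x : ℕ → ℂ) (c d : ℂ) (t : Fin 4) :
    x (β t) * (Pi.single p.castSucc c - Pi.single p.succ d : Fin 4 → ℂ) t =
      x (β p.castSucc) * (Pi.single p.castSucc c - Pi.single p.succ d : Fin 4 → ℂ) t := by
  by_cases h1 : t = p.castSucc
  · rw [h1]
  · by_cases h2 : t = p.succ
    · rw [h2, hp]
    · rw [Pi.sub_apply, Pi.single_eq_of_ne h1, Pi.single_eq_of_ne h2, sub_zero, mul_zero, mul_zero]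

theorem IsScheme.oneToOneAligned
    (hfading : ∀ i a, fading i a ≪ (volume : Measure (Fin 2 → ℂ))) (hn : StrictMono n)
    (hs : IsScheme fading N δ n v u) (hH : ∀ p j, H p j ≠ 0) : OneToOneAligned N δ n H v u := by
  have halg := hs.isAlgebraicScheme hfading hn
  obtain ⟨σ, f, hσ, hf, hv, hu, hdot⟩ := halg.exists_perm
  intro k i j hik hjk hij
  have heq : ∀ w : Fin 4 → ℂ,
      (∀ l b, k ≠ l → blockPart (fun t => blockIndex N (δ l) (n t)) b f ⬝ᵥ w = 0) →
      w = (f (σ k).castSucc * w (σ k).castSucc) •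
        (Pi.single (σ k).castSucc (f (σ k).castSucc)⁻¹ -
          Pi.single (σ k).succ (f (σ k).succ)⁻¹) := fun w hw => by
    have hi := prefix_sum_eq_zero_of_blockPart (halg.mono i) (hσ i) f w
      fun b => hw i b hik.symm
    have hj := prefix_sum_eq_zero_of_blockPart (halg.mono j) (hσ j) f w
      fun b => hw j b hjk.symm
    exact eq_smul_of_blockPart hf (σ.injective.ne hij) (σ.injective.ne hik) (σ.injective.ne hjk)
      hi.1 hj.1 hi.2
  have hvk := heq (v k) fun l b hl => (hdot l k b hl).1
  have huk := heq (u k) fun l b hl => (hdot l k b hl).2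
  generalize f (σ k).castSucc * v k (σ k).castSucc = α at hvk
  generalize f (σ k).castSucc * u k (σ k).castSucc = γ at huk
  have hα : α ≠ 0 := by rintro rfl; rw [zero_smul] at hvk; exact hv k hvk
  have hγ : γ ≠ 0 := by rintro rfl; rw [zero_smul] at huk; exact hu k huk
  have hratio : ∀ l, l ≠ k → ∃ r : ℂ, r ≠ 0 ∧ ratioMatrix N δ n H l *ᵥ u k = r • u k := by
    intro l hl
    refine ⟨H (l, blockIndex N (δ l) (n (σ k).castSucc)) 1 /
      H (l, blockIndex N (δ l) (n (σ k).castSucc)) 0, div_ne_zero (hH _ _) (hH _ _), ?_⟩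
    funext t
    have h := block_mul_sub_single (β := fun t => blockIndex N (δ l) (n t))
      ((hσ l (σ k)).2 (σ.injective.ne hl.symm))
      (fun b => H (l, b) 1 / H (l, b) 0) (f (σ k).castSucc)⁻¹ (f (σ k).succ)⁻¹ t
    rw [ratioMatrix_mulVec, huk, Pi.smul_apply, Pi.smul_apply, smul_eq_mul, smul_eq_mul,
      mul_left_comm, h, mul_left_comm]
    rfl
  obtain ⟨r, hr, hri⟩ := hratio i hik
  obtain ⟨s, hs', hsj⟩ := hratio j hjk
  refine ⟨⟨α / (r * γ), div_ne_zero hα (mul_ne_zero hr hγ), ?_⟩, ⟨r / s, div_ne_zero hr hs', ?_⟩⟩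
  · rw [hri, hvk, huk, smul_smul, smul_smul]
    congr 1
    field_simp
  · rw [hri, hsj, smul_smul, div_mul_cancel₀ _ hs']

theorem transitionMatrix_eq_permMatrix_iff (σ : Equiv.Perm (Fin 3)) :
    transitionMatrix (pattern N δ n) = σ.permMatrix ℕ ↔
      ∀ i (j : Fin 3), blockIndex N (δ i) (n j.castSucc) = blockIndex N (δ i) (n j.succ) ↔
        j ≠ σ i := by
  rw [← Matrix.ext_iff]
  refine forall_congr' fun i => forall_congr' fun j => ?_
  have h1 : transitionMatrix (pattern N δ n) i j =
      if blockIndex N (δ i) (n j.castSucc) = blockIndex N (δ i) (n j.succ) then 0 else 1 := by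
    unfold transitionMatrix
    rw [Matrix.of_apply]
    congr
  have h2 : σ.permMatrix ℕ i j = if j = σ i then 1 else 0 := by
    simp only [Equiv.Perm.permMatrix, PEquiv.toMatrix_apply, Equiv.toPEquiv_apply,
      Option.mem_def, Option.some.injEq, eq_comm]
  rw [h1, h2]
  by_cases ha : blockIndex N (δ i) (n j.castSucc) = blockIndex N (δ i) (n j.succ) <;>
  by_cases hb : j = σ i <;> simp [ha, hb]

/-! ### Sufficiency: an explicit scheme. -/

/-- The two-slot vectors used on both antennas when user `k` has its only transition after
slot `σ k`. -/
def twoSlotVectors (σ : Equiv.Perm (Fin 3)) (k : Fin 3) : Fin 4 → ℂ :=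
  Pi.single (σ k).castSucc 1 - Pi.single (σ k).succ 1

theorem prefix_dotProduct_sub_single (c p : Fin 3) (x y : ℂ) :
    (fun t : Fin 4 => if t ≤ c.castSucc then (1 : ℂ) else 0) ⬝ᵥ
      (Pi.single p.castSucc x - Pi.single p.succ y) =
      (if p ≤ c then x else 0) - if p < c then y else 0 := by
  rw [dotProduct_sub, dotProduct_single, dotProduct_single]
  simp only [Fin.castSucc_le_castSucc_iff, Fin.succ_le_castSucc_iff, ite_mul, one_mul, zero_mul]

/-- User `i` does not change state across the transitions of the others, so its channel only
rescales their vectors. The span thus does not depend on the antenna. -/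
theorem interference_twoSlotVectors {σ : Equiv.Perm (Fin 3)}
    (hσ : ∀ i (j : Fin 3), blockIndex N (δ i) (n j.castSucc) = blockIndex N (δ i) (n j.succ) ↔
      j ≠ σ i) (hH : ∀ p j, H p j ≠ 0) (i : Fin 3) (j : Fin 2) :
    interference N δ n H i j (twoSlotVectors σ) =
      Submodule.span ℂ {y | ∃ k, k ≠ i ∧ y = twoSlotVectors σ k} := by
  have h : ∀ k, k ≠ i → chanMatrix N δ n H i j *ᵥ twoSlotVectors σ k =
      H (i, blockIndex N (δ i) (n (σ k).castSucc)) j • twoSlotVectors σ k := fun k hk => by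
    funext t
    rw [chanMatrix_mulVec]
    exact block_mul_sub_single (β := fun t => blockIndex N (δ i) (n t))
      ((hσ i (σ k)).2 (σ.injective.ne hk)) (fun b => H (i, b) j) 1 1 t
  apply le_antisymm <;> refine Submodule.span_le.2 ?_ <;> rintro y ⟨k, hk, rfl⟩
  · rw [h k hk]
    exact Submodule.smul_mem _ _ (Submodule.subset_span ⟨k, hk, rfl⟩)
  · rw [← inv_smul_smul₀ (hH (i, blockIndex N (δ i) (n (σ k).castSucc)) j) (twoSlotVectors σ k),
      ← h k hk]
    exact Submodule.smul_mem _ _ (Submodule.subset_span ⟨k, hk, rfl⟩)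

theorem feasible_of_transition
    (hfading : ∀ i a, fading i a ≪ (volume : Measure (Fin 2 → ℂ))) {σ : Equiv.Perm (Fin 3)}
    (hσ : ∀ i (j : Fin 3), blockIndex N (δ i) (n j.castSucc) = blockIndex N (δ i) (n j.succ) ↔
      j ≠ σ i) : Feasible fading N δ n := by
  refine ⟨twoSlotVectors σ, twoSlotVectors σ, ?_⟩
  have hne : ∀ i, blockIndex N (δ i) (n (σ i).castSucc) ≠ blockIndex N (δ i) (n (σ i).succ) :=
    fun i h => (hσ i (σ i)).1 h rfl
  have hr := ae_all_iff.2 fun i => ae_ratio_ne (fading := fading) hfading i (hne i)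
  filter_upwards [ae_ne_zero hfading, hr] with H hH hr
  refine ⟨fun i => ?_, fun i a b hab => ?_⟩
  · rw [interference_twoSlotVectors hσ hH, interference_twoSlotVectors hσ hH]
  · rw [interference_twoSlotVectors hσ hH, interference_twoSlotVectors hσ hH, sup_idem] at hab
    have hker : ∀ e : Fin 4 → ℂ, (∀ k, k ≠ i → e ⬝ᵥ twoSlotVectors σ k = 0) →
        ∀ y ∈ Submodule.span ℂ {y | ∃ k, k ≠ i ∧ y = twoSlotVectors σ k}, e ⬝ᵥ y = 0 := by
      intro e he y hy
      induction hy using Submodule.span_induction with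
      | mem y hy => obtain ⟨k, hk, rfl⟩ := hy; exact he k hk
      | zero => exact dotProduct_zero e
      | add x y _ _ hx hy => rw [dotProduct_add, hx, hy, add_zero]
      | smul c y _ hy => rw [dotProduct_smul, hy, smul_zero]
    have hchan : ∀ j, chanMatrix N δ n H i j *ᵥ twoSlotVectors σ i =
        Pi.single (σ i).castSucc (H (i, blockIndex N (δ i) (n (σ i).castSucc)) j) -
          Pi.single (σ i).succ (H (i, blockIndex N (δ i) (n (σ i).succ)) j) := by
      intro j
      funext t
      rw [chanMatrix_mulVec]
      simp only [twoSlotVectors, Pi.sub_apply, Pi.single_apply]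
      by_cases h1 : t = (σ i).castSucc
      · have h2 : t ≠ (σ i).succ := by rw [h1]; exact (σ i).castSucc_lt_succ.ne
        rw [if_pos h1, if_neg h2, if_pos h1, if_neg h2, h1]
        ring
      · by_cases h2 : t = (σ i).succ
        · rw [if_neg h1, if_pos h2, if_neg h1, if_pos h2, h2]
          ring
        · rw [if_neg h1, if_neg h2, if_neg h1, if_neg h2]
          ring
    rw [hchan, hchan] at hab
    -- The prefix sum up to the transition of user `i` and the total sum both kill the interference.
    -- They leave two equations in `a`, `b`, whose determinant is nonzero because the two block
    -- ratios differ.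
    have h1 := hker (fun t => if t ≤ (σ i).castSucc then 1 else 0) (fun k hk => by
      rw [twoSlotVectors, prefix_dotProduct_sub_single]
      rcases lt_or_gt_of_ne (σ.injective.ne hk) with h | h
      · rw [if_pos h.le, if_pos h, sub_self]
      · rw [if_neg h.not_ge, if_neg h.asymm, sub_self]) _ hab
    have h2 := hker 1 (fun k _ => by
      rw [twoSlotVectors, dotProduct_sub, dotProduct_single, dotProduct_single, Pi.one_apply,
        Pi.one_apply, sub_self]) _ hab
    rw [dotProduct_add, dotProduct_smul, dotProduct_smul, prefix_dotProduct_sub_single,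
      prefix_dotProduct_sub_single, if_pos le_rfl, if_neg (lt_irrefl _), if_pos le_rfl,
      if_neg (lt_irrefl _), sub_zero, sub_zero, smul_eq_mul, smul_eq_mul] at h1
    simp only [dotProduct_add, dotProduct_smul, dotProduct_sub, dotProduct_single, Pi.one_apply,
      one_mul, smul_eq_mul] at h2
    have hri := hr i
    have hx := hH (i, blockIndex N (δ i) (n (σ i).castSucc)) 0
    have hy := hH (i, blockIndex N (δ i) (n (σ i).succ)) 0
    rw [Ne, div_eq_div_iff hx hy, ← sub_eq_zero] at hri
    have hb : b = 0 := by
      refine (mul_eq_zero.1 ?_).resolve_right hri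
      linear_combination (H (i, blockIndex N (δ i) (n (σ i).succ)) 0 -
        H (i, blockIndex N (δ i) (n (σ i).castSucc)) 0) * h1 +
        H (i, blockIndex N (δ i) (n (σ i).castSucc)) 0 * h2
    rw [hb, zero_mul, add_zero] at h1
    exact ⟨(mul_eq_zero.1 h1).resolve_right hx, hb⟩

theorem feasible_iff (hfading : ∀ i a, fading i a ≪ (volume : Measure (Fin 2 → ℂ)))
    (hn : StrictMono n) : Feasible fading N δ n ↔
      IsPermutationMatrix (transitionMatrix (pattern N δ n)) := by
  constructor
  · rintro ⟨v, u, hs⟩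
    obtain ⟨σ, -, hσ, -⟩ := (hs.isAlgebraicScheme hfading hn).exists_perm
    exact ⟨σ, (transitionMatrix_eq_permMatrix_iff σ).2 hσ⟩
  · rintro ⟨σ, hσ⟩
    exact feasible_of_transition hfading ((transitionMatrix_eq_permMatrix_iff σ).1 hσ)

/-! ### Counting the feasible patterns. -/

/-- The pattern in which user `i` has its only transition after slot `σ i`. -/
abbrev permPattern (σ : Equiv.Perm (Fin 3)) : Pattern :=
  fun i => Setoid.ker fun t : Fin 4 => t ≤ (σ i).castSucc

theorem permPattern_injective : Function.Injective permPattern := by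
  intro σ τ h
  have key : ∀ (ρ : Equiv.Perm (Fin 3)) i (j : Fin 3),
      (permPattern ρ i).r j.castSucc j.succ ↔ j ≠ ρ i := by
    intro ρ i j
    change ((j.castSucc ≤ (ρ i).castSucc) = (j.succ ≤ (ρ i).castSucc)) ↔ _
    rw [eq_iff_iff, Fin.castSucc_le_castSucc_iff, Fin.succ_le_castSucc_iff]
    exact ⟨fun h he => absurd (h.1 he.le) (he ▸ lt_irrefl _),
      fun h => ⟨fun hl => hl.lt_of_ne h, le_of_lt⟩⟩
  ext1 i
  by_contra hne
  exact (key σ i (σ i)).1 (h ▸ (key τ i (σ i)).2 hne) rfl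

theorem pattern_eq_permPattern (hn : StrictMono n) {σ : Equiv.Perm (Fin 3)}
    (hσ : ∀ i (j : Fin 3), blockIndex N (δ i) (n j.castSucc) = blockIndex N (δ i) (n j.succ) ↔
      j ≠ σ i) : pattern N δ n = permPattern σ := by
  funext i
  refine Setoid.ext fun s t => ?_
  change (blockIndex N (δ i) (n s) = blockIndex N (δ i) (n t)) ↔
    ((s ≤ (σ i).castSucc) = (t ≤ (σ i).castSucc))
  rw [eq_iff_iff]
  exact eq_iff_of_transition ((blockIndex_monotone N (δ i)).comp hn.monotone) (hσ i) s t

theorem feasiblePatterns_eq_range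
    (hfading : ∀ i a, fading i a ≪ (volume : Measure (Fin 2 → ℂ))) :
    feasiblePatterns fading = Set.range permPattern := by
  ext P
  constructor
  · rintro ⟨N, δ, n, -, hn, rfl, hfeas⟩
    obtain ⟨σ, hσ⟩ := (feasible_iff hfading hn).1 hfeas
    exact ⟨σ, (pattern_eq_permPattern hn ((transitionMatrix_eq_permMatrix_iff σ).1 hσ)).symm⟩
  · rintro ⟨σ, rfl⟩
    -- Witness: slots `0, …, 3` with `N = 4`. The offset `σ i + 1` puts slots up to `σ i` in block
    -- `0`, and the at most three remaining slots fit in block `1`.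
    have hσ : ∀ i (j : Fin 3), blockIndex 4 ((σ i : ℕ) + 1) (j.castSucc : Fin 4) =
        blockIndex 4 ((σ i : ℕ) + 1) (j.succ : Fin 4) ↔ j ≠ σ i := by
      intro i j
      have hj := j.isLt
      rw [Ne, Fin.ext_iff, Fin.val_castSucc, Fin.val_succ]
      unfold blockIndex
      split_ifs <;> first | omega | (rw [false_iff, not_not]; omega)
    exact ⟨4, fun i => (σ i : ℕ) + 1, Fin.val, fun i => Nat.succ_lt_succ (σ i).isLt,
      Fin.val_strictMono, pattern_eq_permPattern Fin.val_strictMono hσ,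
      feasible_of_transition hfading hσ⟩

end Scheme

end BIA

theorem mainTheorem8
    (fading : Fin 3 → ℕ → Measure (Fin 2 → ℂ))
    [∀ i a, IsProbabilityMeasure (fading i a)]
    (hfading : ∀ i a, fading i a ≪ (volume : Measure (Fin 2 → ℂ))) :
    (∀ (N : ℕ) (δ : Fin 3 → ℕ) (n : Fin 4 → ℕ), (∀ i, δ i < N) → StrictMono n →
      (∀ v u : Fin 3 → Fin 4 → ℂ, BIA.IsScheme fading N δ n v u →
        ∀ H : BIA.Channel, (∀ p j, H p j ≠ 0) → BIA.OneToOneAligned N δ n H v u) ∧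
      (BIA.Feasible fading N δ n ↔
        BIA.IsPermutationMatrix (BIA.transitionMatrix (BIA.pattern N δ n)))) ∧
    (BIA.feasiblePatterns fading).ncard = Nat.factorial 3 := by
  refine ⟨fun N δ n _ hn => ⟨fun v u hs H hH => hs.oneToOneAligned hfading hn hH,
    BIA.feasible_iff hfading hn⟩, ?_⟩
  rw [BIA.feasiblePatterns_eq_range hfading, Set.ncard_range_of_injective BIA.permPattern_injective,
    Nat.card_perm, Nat.card_eq_fintype_card, Fintype.card_fin]
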